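/- \textbf{Theorem 2 (folk theorem with publicly observed transfers).} \emph{Setting.} Let $N$ be a finite set of players and $A$ a finite set of alternatives. A coalition is a nonempty subset of $N$. Alternative $a$ generates payoffs $v(a)\in\mathbb R^N$, and if $a$ is recommended, coalition $C$ can move to any alternative in $E_C(a)\subseteq A$, where $a\in E_C(a)$ for all $a$ and $C$. Transfers are matrices $T=(T_{ij})_{i,j\in N}$ with entries $T_{ij}\ge 0$, where $T_{ij}$ is paid by $i$ to $j$; the experienced payoff of player $i$ is $u_i(a,T)=v_i(a)+\sum_j T_{ji}-\sum_j T_{ij}$. An outcome is a triple $(a,C,T)$ of an alternative, the blocking coalition ($C=\emptyset$ if there is none) and transfers. A history $h$ is a finite (possibly empty) sequence of outcomes. A convention $\sigma$ assigns to every history $h$ an outcome $(a(h|\sigma),\emptyset,T(h|\sigma))$. For a discount factor $\delta\in[0,1)$, $U_i(h|\sigma)=(1-\delta)\sum_{t\ge 0}\delta^t u_i(a^t,T^t)$, where $(a^t,\emptyset,T^t)_{t\ge0}$ is the path generated by following $\sigma$ after $h$. Only conventions are considered for which these values exist and $\{U(h|\sigma): h \text{ a history}\}$ is a bounded subset of $\mathbb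 R^N$. A convention $\sigma$ is \emph{stable} (for $\delta$) if there are no history $h$, coalition $C$, alternative $a'\in E_C(a(h|\sigma))$ and transfers $T'_C=[T'_{ij}]_{i\in C,\,j\in N}$ with nonnegative entries such that, with $T'=[T'_C,T_{-C}(h|\sigma)]$, $$(1-\delta)\,u_i(a',T')+\delta\, U_i(h,(a',C,T')\,|\,\sigma)>U_i(h|\sigma)\quad\text{for every } i\in C.$$ Let $\underline v_i=\min_{a\in A}\max_{a'\in E_{\{i\}}(a)}v_i(a')$, let $\mathcal U^\dagger$ be the convex hull of $\bigcup_{a\in A}\{u\in\mathbb R^N:\sum_i u_i=\sum_i v_i(a)\}$, and let $\mathcal U^\dagger_{IR}=\{u\in\mathcal U^\dagger: u_i>\underline v_i \text{ for every } i\in N\}$. \emph{Claim.} (1) For every $\delta\in[0,1)$, every stable convention $\sigma$ gives each player $i$ a payoff $U_i(\emptyset|\sigma)\ge\underline v_i$. (2) For every $u\in\mathcal U^\dagger_{IR}$ there is a $\underline\delta\in[0,1)$ such that for every $\delta\in(\underline\delta,1)$ there is a stable convention $\sigma$ with $U(\emptyset|\sigma)=u$. -/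

import Mathlib

open scoped NNReal

noncomputable section

namespace Convention

/-- A stage game with players `N` and alternatives `A`: the payoff `v a i` that alternative `a`
generates for player `i`, and the effectivity correspondence, where `E C a` is the set of
alternatives to which coalition `C` can move when `a` is recommended.
Coalitions are the nonempty sets of players. -/
structure StageGame (N A : Type*) where
  v : A → N → ℝ
  E : Finset N → A → Set A
  refl : ∀ C : Finset N, C.Nonempty → ∀ a, a ∈ E C a

/-- An outcome `(a, C, T)`: the chosen alternative, the blocking coalition (`∅` if the
recommendation is not blocked) and the transfers, where `T i j ≥ 0` is paid by `i` to `j`. -/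
structure Outcome (N A : Type*) where
  alt : A
  coal : Finset N
  trans : Matrix N N ℝ≥0

/-- A history is the finite list of past outcomes, the oldest one first. -/
abbrev History (N A : Type*) := List (Outcome N A)

/-- A plan recommends an outcome after every history. -/
abbrev Plan (N A : Type*) := History N A → Outcome N A

/-- A convention is a plan that recommends only unblocked outcomes. -/
def IsConvention {N A : Type*} (σ : Plan N A) : Prop :=
  ∀ h, (σ h).coal = ∅

/-- The history that is reached from `h` when `σ` is followed for `t` periods. -/
def historyAfter {N A : Type*} (σ : Plan N A) (h : History N A) : ℕ → History N A
  | 0 => h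
  | t + 1 => historyAfter σ h t ++ [σ (historyAfter σ h t)]

/-- The outcome path `(σ(h), σ(h, σ(h)), …)` that `σ` generates after `h`. -/
def path {N A : Type*} (σ : Plan N A) (h : History N A) (t : ℕ) : Outcome N A :=
  σ (historyAfter σ h t)

/-- The transfers `[T'_C, T_{-C}]`: members of `C` pay according to `T'`, the others according
to `T`. -/
def splice {N : Type*} [DecidableEq N] (C : Finset N) (T' T : Matrix N N ℝ≥0) :
    Matrix N N ℝ≥0 :=
  fun i j => if i ∈ C then T' i j else T i j

namespace StageGame

variable {N A : Type*} (G : StageGame N A)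

/-- Player `i`'s minmax payoff `min_{a} max_{a' ∈ E_{i}(a)} v_i(a')`. For finite nonempty `A`,
infimum and supremum are over finite nonempty sets, hence attained. -/
def minmax (i : N) : ℝ :=
  ⨅ a : A, ⨆ a' : G.E {i} a, G.v a' i

variable [Fintype N]

/-- The experienced payoff `u_i(a, T)`: generated payoff plus incoming minus outgoing transfers. -/
def payoff (a : A) (T : Matrix N N ℝ≥0) (i : N) : ℝ :=
  G.v a i + ∑ j, (T j i : ℝ) - ∑ j, (T i j : ℝ)

/-- The experienced payoff profiles that transfers can generate after alternative `a`. -/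
def payoffsAt (a : A) : Set (N → ℝ) :=
  {u | ∑ i, u i = ∑ i, G.v a i}

/-- The feasible payoffs of the game with transfers. -/
def feasible : Set (N → ℝ) :=
  convexHull ℝ (⋃ a, G.payoffsAt a)

/-- The feasible and strictly individually rational payoffs of the game with transfers. -/
def feasibleIR : Set (N → ℝ) :=
  {u | u ∈ G.feasible ∧ ∀ i, G.minmax i < u i}

/-- The discounted experienced payoff in period `t` of the path that `σ` generates after `h`. -/
def term (δ : ℝ) (σ : Plan N A) (h : History N A) (i : N) (t : ℕ) : ℝ :=
  δ ^ t * G.payoff (path σ h t).alt (path σ h t).trans i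

/-- The normalized discounted continuation payoff `U_i(h | σ)`. -/
def value (δ : ℝ) (σ : Plan N A) (h : History N A) (i : N) : ℝ :=
  (1 - δ) * ∑' t, G.term δ σ h i t

/-- The continuation values of `σ` exist and are bounded across histories. For `0 ≤ δ < 1`,
it makes no difference whether the discounted sums are asked to converge or to converge
absolutely: if they converge and the continuation values are bounded, then so are the stage
payoffs that `σ` recommends. -/
def BoundedValues (δ : ℝ) (σ : Plan N A) : Prop :=
  (∀ h i, Summable (G.term δ σ h i)) ∧
    Bornology.IsBounded (Set.range fun h => G.value δ σ h)

/-- No coalition has a profitable one-shot deviation, in alternatives and in the transfers that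
its members pay, after any history. -/
def IsStable [DecidableEq N] (δ : ℝ) (σ : Plan N A) : Prop :=
  ∀ h : History N A,
    ¬ ∃ C : Finset N, C.Nonempty ∧
      ∃ a' ∈ G.E C (σ h).alt, ∃ T' : Matrix N N ℝ≥0,
        ∀ i ∈ C,
          G.value δ σ h i <
            (1 - δ) * G.payoff a' (splice C T' (σ h).trans) i +
              δ * G.value δ σ (h ++ [⟨a', C, splice C T' (σ h).trans⟩]) i

end StageGame

end Convention

end

/-! ### Transfers, two-valued payoff paths and powers of the discount factor -/

noncomputable section

namespace Convention

open Finset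

/-! Lower bound: a player can block alone, pay nothing and move to a best alternative. This earns at
least the minmax payoff today and at least the infimum of that player's values later, so the infimum
itself is at least the minmax payoff.

Converse: transfers reduce feasibility to the total payoff, which can be divided at will. Hence each
player `i` has a profile `w (some i)` that is worse for `i` than every other target, with no
dimension condition. Instead of randomizing, the path mixes the alternatives of extreme total over
time (`exists_two_value_path`), and fluctuations of the total are shared equally. A block starts `L`
periods of a blocking player's minmax alternative without transfers, followed by that player's
profile. `L` grows with `δ` so that `δ ^ L` stays near `1 - θ` and the punishment keeps its weight.
Transfers inside a coalition cancel and the prescribed ones form a finite family, so its joint gain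
today is at most `(1 - δ) * B`. Punishment costs some member at least that much, so some member does
not gain (`exists_not_gain`); as transfers are observed, that member can be punished
(`exists_stable_of_phases`). The exception is a punished player who blocks alone: this yields at
most the minmax payoff and restarts the punishment. -/

/-- Every profile of net receipts that sums to zero is generated by nonnegative transfers. -/
theorem exists_transfers {N : Type*} [Fintype N] (z : N → ℝ) (hz : ∑ i, z i = 0) :
    ∃ T : Matrix N N ℝ≥0, ∀ i, ∑ j, (T j i : ℝ) - ∑ j, (T i j : ℝ) = z i := by
  -- Each pair settles `1 / n` of the difference of its entries of `z`; only one of the two pays.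
  refine ⟨fun i j => ((z j - z i) / Fintype.card N).toNNReal, fun i => ?_⟩
  have hn : (Fintype.card N : ℝ) ≠ 0 :=
    Nat.cast_ne_zero.mpr (Fintype.card_pos_iff.mpr ⟨i⟩).ne'
  rw [← Finset.sum_sub_distrib]
  have key : ∀ j, ((((z i - z j) / Fintype.card N).toNNReal : ℝ≥0) : ℝ) -
      (((z j - z i) / Fintype.card N).toNNReal : ℝ≥0) = (z i - z j) / Fintype.card N := by
    intro j
    rw [Real.coe_toNNReal', Real.coe_toNNReal',
      show (z j - z i) / (Fintype.card N : ℝ) = -((z i - z j) / Fintype.card N) by ring]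
    exact max_zero_sub_eq_self _
  rw [Finset.sum_congr rfl fun j _ => key j, ← Finset.sum_div, Finset.sum_sub_distrib, hz]
  simp only [sum_const, card_univ, nsmul_eq_mul, sub_zero]
  field_simp

/-- A discounted value between `m` and `M` is generated by a sequence of stage values `m` and `M`
along which the continuation values do not fall far below the initial one. -/
theorem exists_two_value_path {δ m M W₀ : ℝ} (hδ : 1 / 2 ≤ δ) (hδ1 : δ < 1)
    (hm : m ≤ W₀) (hM : W₀ ≤ M) :
    ∃ (b : ℕ → Bool) (W : ℕ → ℝ), W 0 = W₀ ∧
      (∀ t, W t = (1 - δ) * (if b t then M else m) + δ * W (t + 1)) ∧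
      ∀ t, m ≤ W t ∧ W t ≤ M ∧ W₀ - 4 * (1 - δ) * (M - m) ≤ W t := by
  have hδ0 : 0 < δ := by linarith
  have step : ∀ x : {x : ℝ // m ≤ x ∧ x ≤ M ∧ W₀ - 4 * (1 - δ) * (M - m) ≤ x},
      ∃ (c : Bool) (y : {x : ℝ // m ≤ x ∧ x ≤ M ∧ W₀ - 4 * (1 - δ) * (M - m) ≤ x}),
        (x : ℝ) = (1 - δ) * (if c then M else m) + δ * y := by
    rintro ⟨x, hxm, hxM, hx⟩
    have hmM : 0 ≤ M - m := by linarith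
    have he : 0 ≤ 1 - δ := by linarith
    have hp : 0 ≤ (1 - δ) * (M - m) := mul_nonneg he hmM
    -- Stage value `m` raises the continuation value and `M` lowers it. Below `W₀` use `m` unless
    -- that overshoots `M`; otherwise use `M` unless that falls below `m`.
    by_cases hc : (x < W₀ ∧ x ≤ δ * M + (1 - δ) * m) ∨ x < δ * m + (1 - δ) * M
    · have hup : x ≤ δ * M + (1 - δ) * m := by
        rcases hc with hc | hc
        · exact hc.2
        · nlinarith
      have hge : x ≤ (x - (1 - δ) * m) / δ := by
        rw [le_div_iff₀ hδ0]; nlinarith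
      refine ⟨false, ⟨(x - (1 - δ) * m) / δ, hxm.trans hge, ?_, hx.trans hge⟩, ?_⟩
      · rw [div_le_iff₀ hδ0]; linarith
      · simp only [Bool.false_eq_true, if_false]; field_simp; ring
    · push Not at hc
      obtain ⟨hc1, hc2⟩ := hc
      have hlow : W₀ - (1 - δ) * (M - m) ≤ x := by
        by_cases hxW : x < W₀
        · have := hc1 hxW; linarith
        · linarith
      refine ⟨true, ⟨(x - (1 - δ) * M) / δ, ?_, ?_, ?_⟩, ?_⟩
      · rw [le_div_iff₀ hδ0]; linarith
      · rw [div_le_iff₀ hδ0]; nlinarith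
      -- By `1 / 2 ≤ δ`, one use of `M` lowers the value by at most `2 * (1 - δ) * (M - m)`. With
      -- `hlow` the total drop is at most three such units `(1 - δ) * (M - m)`.
      · have h2 : x - 2 * ((1 - δ) * (M - m)) ≤ (x - (1 - δ) * M) / δ := by
          rw [le_div_iff₀ hδ0]
          nlinarith [mul_nonneg he (sub_nonneg.mpr hxm),
            mul_nonneg hp (by linarith : 0 ≤ 2 * δ - 1)]
        linarith
      · simp only [if_true]; field_simp; ring
  choose c y hy using step
  have h0 : W₀ - 4 * (1 - δ) * (M - m) ≤ W₀ := by
    have := mul_nonneg (by linarith : 0 ≤ 1 - δ) (by linarith : 0 ≤ M - m)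
    linarith
  let X : ℕ → {x : ℝ // m ≤ x ∧ x ≤ M ∧ W₀ - 4 * (1 - δ) * (M - m) ≤ x} :=
    fun t => y^[t] ⟨W₀, hm, hM, h0⟩
  refine ⟨fun t => c (X t), fun t => X t, rfl, fun t => ?_, fun t => (X t).2⟩
  have hX : X (t + 1) = y (X t) := Function.iterate_succ_apply' _ _ _
  simpa only [hX] using hy (X t)

/-- For `δ` close to `1`, some power of `δ` lies between `1 - 2 * θ` and `1 - θ`. -/
theorem exists_pow_mem_Icc {δ θ : ℝ} (hθ0 : 0 < θ) (hθ1 : θ < 1) (hδ : 1 - θ ≤ δ)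
    (hδ1 : δ < 1) : ∃ L : ℕ, 1 - 2 * θ ≤ δ ^ L ∧ δ ^ L ≤ 1 - θ := by
  have hδ0 : 0 ≤ δ := by linarith
  have hex : ∃ L : ℕ, δ ^ L ≤ 1 - θ :=
    (exists_pow_lt_of_lt_one (by linarith : 0 < 1 - θ) hδ1).imp fun _ h => h.le
  classical
  refine ⟨Nat.find hex, ?_, Nat.find_spec hex⟩
  -- The first power below `1 - θ` is `δ` times one above it, hence at least `(1 - θ) ^ 2`.
  rcases hL : Nat.find hex with _ | k
  · rw [pow_zero]; linarith
  · have := Nat.find_min hex (m := k) (by omega)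
    rw [pow_succ]
    nlinarith

variable {N A : Type*}

namespace StageGame

/-! ### Attainment of the minmax payoff -/

section

variable [Finite A] (G : StageGame N A)

theorem exists_minmax_le [Nonempty A] (i : N) (a : A) :
    ∃ a' ∈ G.E {i} a, G.minmax i ≤ G.v a' i := by
  have : Nonempty (G.E {i} a) := ⟨⟨a, G.refl _ (singleton_nonempty i) a⟩⟩
  obtain ⟨a', ha'⟩ := exists_eq_ciSup_of_finite (f := fun a' : G.E {i} a => G.v a' i)
  refine ⟨a', a'.2, ?_⟩
  rw [ha']
  exact ciInf_le (Set.finite_range fun a : A => ⨆ a' : G.E {i} a, G.v a' i).bddBelow a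

theorem exists_forall_le_minmax [Nonempty A] (i : N) :
    ∃ a, ∀ a' ∈ G.E {i} a, G.v a' i ≤ G.minmax i := by
  obtain ⟨a, ha⟩ := exists_eq_ciInf_of_finite (f := fun a : A => ⨆ a' : G.E {i} a, G.v a' i)
  refine ⟨a, fun a' h => ?_⟩
  rw [minmax, ← ha]
  exact le_ciSup (Set.finite_range fun a' : G.E {i} a => G.v a' i).bddAbove ⟨a', h⟩

end

/-! ### Coalition budgets and the lower bound -/

variable [Fintype N] (G : StageGame N A)

/-- The members of a deviating coalition cannot jointly obtain more than what they generate and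
what the others were going to pay them. -/
theorem sum_payoff_splice_le [DecidableEq N] (C : Finset N) (a : A) (T' T : Matrix N N ℝ≥0) :
    ∑ i ∈ C, G.payoff a (splice C T' T) i ≤ ∑ i ∈ C, G.v a i + ∑ i ∈ C, ∑ j, (T j i : ℝ) := by
  set P := splice C T' T with hP
  have h1 : ∀ i, ∑ j, (P j i : ℝ) ≤ ∑ j ∈ C, (P j i : ℝ) + ∑ j, (T j i : ℝ) := by
    intro i
    rw [← sum_add_sum_compl C fun j => (P j i : ℝ)]
    gcongr
    calc ∑ j ∈ Cᶜ, (P j i : ℝ) = ∑ j ∈ Cᶜ, (T j i : ℝ) := by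
          refine sum_congr rfl fun j hj => ?_
          rw [hP, splice, if_neg (mem_compl.mp hj)]
      _ ≤ ∑ j, (T j i : ℝ) := sum_le_univ_sum_of_nonneg fun j => (T j i).2
  have h2 : ∀ i, ∑ j ∈ C, (P i j : ℝ) ≤ ∑ j, (P i j : ℝ) := fun i =>
    sum_le_univ_sum_of_nonneg fun j => (P i j).2
  have h3 : ∑ i ∈ C, ∑ j ∈ C, (P j i : ℝ) = ∑ i ∈ C, ∑ j ∈ C, (P i j : ℝ) := sum_comm
  have h4 := sum_le_sum fun i (_ : i ∈ C) => h1 i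
  have h5 := sum_le_sum fun i (_ : i ∈ C) => h2 i
  simp only [payoff, sum_sub_distrib, sum_add_distrib] at h4 h5 ⊢
  linarith

theorem le_payoff_splice_singleton [DecidableEq N] (i : N) (a : A) (T : Matrix N N ℝ≥0) :
    G.v a i ≤ G.payoff a (splice {i} 0 T) i := by
  have h : ∑ j, ((splice {i} 0 T i j : ℝ≥0) : ℝ) = 0 :=
    sum_eq_zero fun j _ => by simp [splice]
  have h' : 0 ≤ ∑ j, ((splice {i} 0 T j i : ℝ≥0) : ℝ) := sum_nonneg fun j _ => NNReal.coe_nonneg _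
  rw [payoff, h]
  linarith

/-- Stable conventions give each player at least the minmax payoff after every history. -/
theorem minmax_le_value [Finite A] [DecidableEq N] {δ : ℝ} (hδ0 : 0 ≤ δ) (hδ1 : δ < 1)
    {σ : Plan N A} (hb : G.BoundedValues δ σ) (hs : G.IsStable δ σ) (h : History N A) (i : N) :
    G.minmax i ≤ G.value δ σ h i := by
  have : Nonempty A := ⟨(σ []).alt⟩
  obtain ⟨K, hK⟩ := hb.2.exists_norm_le
  have hbdd : BddBelow (Set.range fun h => G.value δ σ h i) := by
    refine ⟨-K, ?_⟩
    rintro _ ⟨h, rfl⟩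
    have := (norm_le_pi_norm (G.value δ σ h) i).trans (hK _ ⟨h, rfl⟩)
    exact (abs_le.mp this).1
  have hstep : ∀ h, (1 - δ) * G.minmax i + δ * (⨅ h, G.value δ σ h i) ≤ G.value δ σ h i := by
    intro h
    obtain ⟨a', ha', hle⟩ := G.exists_minmax_le i (σ h).alt
    by_contra hlt
    refine hs h ⟨{i}, singleton_nonempty i, a', ha', 0, fun j hj => ?_⟩
    obtain rfl := mem_singleton.mp hj
    refine (not_le.mp hlt).trans_le (add_le_add ?_ ?_)
    · exact mul_le_mul_of_nonneg_left (hle.trans (G.le_payoff_splice_singleton _ _ _))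
        (by linarith)
    · exact mul_le_mul_of_nonneg_left (ciInf_le hbdd _) hδ0
  have hinf := le_ciInf hstep
  have : G.minmax i ≤ ⨅ h, G.value δ σ h i := by nlinarith
  exact this.trans (ciInf_le hbdd h)

/-! ### Conventions defined by phases -/

section Automaton

variable [DecidableEq N]

open Classical in
/-- The phase transition after the outcome `o`: an unblocked outcome moves the current phase
forward; after a block, the phase of a blocking player who does not gain starts. -/
def nextPhase (δ : ℝ) (V : Option N → ℕ → N → ℝ) (s : Option N × ℕ) (o : Outcome N A) :
    Option N × ℕ :=
  if o.coal = ∅ then (s.1, s.2 + 1)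
  else if h : ∃ i ∈ o.coal,
      (1 - δ) * G.payoff o.alt o.trans i + δ * V (some i) 0 i ≤ V s.1 s.2 i then
    (some h.choose, 0)
  -- A default that is never needed after a feasible block, by `hdev` in `exists_stable_of_phases`.
  else s

/-- The phase that is reached after a history. -/
def phase (δ : ℝ) (V : Option N → ℕ → N → ℝ) (h : History N A) : Option N × ℕ :=
  h.foldl (G.nextPhase δ V) (none, 0)

/-- The plan that recommends the outcomes prescribed by the current phase. -/
def phasePlan (δ : ℝ) (V : Option N → ℕ → N → ℝ) (alt : Option N → ℕ → A)
    (tr : Option N → ℕ → Matrix N N ℝ≥0) : Plan N A :=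
  fun h => ⟨alt (G.phase δ V h).1 (G.phase δ V h).2, ∅, tr (G.phase δ V h).1 (G.phase δ V h).2⟩

theorem phase_historyAfter (δ : ℝ) (V : Option N → ℕ → N → ℝ) (alt : Option N → ℕ → A)
    (tr : Option N → ℕ → Matrix N N ℝ≥0) (h : History N A) (t : ℕ) :
    G.phase δ V (historyAfter (G.phasePlan δ V alt tr) h t) =
      ((G.phase δ V h).1, (G.phase δ V h).2 + t) := by
  induction t with
  | zero => rfl
  | succ t ih =>
    rw [historyAfter, phase, List.foldl_append, ← phase, ih]
    simp [nextPhase, phasePlan, add_assoc]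

variable {G} in
-- The recursion for `V` makes the discounted payoffs telescope, and boundedness removes the tail.
theorem hasSum_term_phasePlan {δ : ℝ} (hδ0 : 0 ≤ δ) (hδ1 : δ < 1)
    {alt : Option N → ℕ → A} {tr : Option N → ℕ → Matrix N N ℝ≥0} {V : Option N → ℕ → N → ℝ}
    {K : ℝ} (hK : ∀ g t i, |V g t i| ≤ K)
    (hV : ∀ g t i, V g t i = (1 - δ) * G.payoff (alt g t) (tr g t) i + δ * V g (t + 1) i)
    (h : History N A) (i : N) :
    HasSum (G.term δ (G.phasePlan δ V alt tr) h i)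
      (V (G.phase δ V h).1 (G.phase δ V h).2 i / (1 - δ)) := by
  set g := (G.phase δ V h).1
  set s := (G.phase δ V h).2
  have he : 0 < 1 - δ := by linarith
  have hterm : ∀ t, G.term δ (G.phasePlan δ V alt tr) h i t =
      (δ ^ t * V g (s + t) i - δ ^ (t + 1) * V g (s + (t + 1)) i) / (1 - δ) := by
    intro t
    have hpath : path (G.phasePlan δ V alt tr) h t = ⟨alt g (s + t), ∅, tr g (s + t)⟩ := by
      simp only [path]
      rw [phasePlan, G.phase_historyAfter δ V alt tr h t]
    rw [term, hpath]
    rw [hV g (s + t) i, eq_div_iff he.ne', ← add_assoc]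
    ring
  have hlim : Filter.Tendsto (fun t => δ ^ t * V g (s + t) i) Filter.atTop (nhds 0) := by
    refine squeeze_zero_norm (a := fun t => δ ^ t * K) (fun t => ?_) ?_
    · rw [norm_mul, norm_pow, Real.norm_of_nonneg hδ0]
      exact mul_le_mul_of_nonneg_left (hK _ _ _) (pow_nonneg hδ0 t)
    · simpa using (tendsto_pow_atTop_nhds_zero_of_lt_one hδ0 hδ1).mul_const K
  have hsum : Summable (G.term δ (G.phasePlan δ V alt tr) h i) := by
    refine Summable.of_norm_bounded (g := fun t => δ ^ t * (2 * K / (1 - δ)))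
      ((summable_geometric_of_lt_one hδ0 hδ1).mul_right _) fun t => ?_
    rw [hterm, norm_div, Real.norm_of_nonneg he.le, mul_div_assoc']
    refine div_le_div_of_nonneg_right ?_ he.le
    rw [pow_succ, mul_assoc, ← mul_sub, norm_mul, norm_pow, Real.norm_of_nonneg hδ0]
    refine mul_le_mul_of_nonneg_left ?_ (pow_nonneg hδ0 t)
    refine (norm_sub_le _ _).trans ?_
    rw [norm_mul, Real.norm_of_nonneg hδ0]
    have h1 := hK g (s + t) i
    have h2 := hK g (s + (t + 1)) i
    rw [Real.norm_eq_abs, Real.norm_eq_abs]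
    nlinarith [abs_nonneg (V g (s + (t + 1)) i)]
  rw [hsum.hasSum_iff_tendsto_nat]
  have hpart : ∀ n, ∑ t ∈ range n, G.term δ (G.phasePlan δ V alt tr) h i t =
      (V g s i - δ ^ n * V g (s + n) i) / (1 - δ) := by
    intro n
    rw [sum_congr rfl fun t _ => hterm t, ← sum_div,
      sum_range_sub' fun t => δ ^ t * V g (s + t) i]
    simp
  simp only [hpart]
  simpa using (hlim.const_sub (V g s i)).div_const (1 - δ)

/-- Phases with bounded values such that from each block some blocking player does not gain, when
that player's own phase starts afterwards, define a stable convention. -/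
theorem exists_stable_of_phases {δ : ℝ} (hδ0 : 0 ≤ δ) (hδ1 : δ < 1)
    (alt : Option N → ℕ → A) (tr : Option N → ℕ → Matrix N N ℝ≥0) (V : Option N → ℕ → N → ℝ)
    (K : ℝ) (hK : ∀ g t i, |V g t i| ≤ K)
    (hV : ∀ g t i, V g t i = (1 - δ) * G.payoff (alt g t) (tr g t) i + δ * V g (t + 1) i)
    (hdev : ∀ g t (C : Finset N), C.Nonempty → ∀ a' ∈ G.E C (alt g t), ∀ T' : Matrix N N ℝ≥0,
      ∃ i ∈ C, (1 - δ) * G.payoff a' (splice C T' (tr g t)) i + δ * V (some i) 0 i ≤ V g t i) :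
    ∃ σ : Plan N A, IsConvention σ ∧ G.BoundedValues δ σ ∧ G.IsStable δ σ ∧
      ∀ i, G.value δ σ [] i = V none 0 i := by
  have hsum := hasSum_term_phasePlan hδ0 hδ1 hK hV
  have hval : ∀ h i, G.value δ (G.phasePlan δ V alt tr) h i =
      V (G.phase δ V h).1 (G.phase δ V h).2 i := by
    intro h i
    rw [value, (hsum h i).tsum_eq, mul_div_cancel₀ _ (by linarith)]
  refine ⟨G.phasePlan δ V alt tr, fun h => rfl, ⟨fun h i => (hsum h i).summable, ?_⟩, ?_,
    fun i => hval [] i⟩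
  · refine isBounded_iff_forall_norm_le.mpr ⟨|K|, ?_⟩
    rintro _ ⟨h, rfl⟩
    refine (pi_norm_le_iff_of_nonneg (abs_nonneg K)).mpr fun i => ?_
    simp only [hval, Real.norm_eq_abs]
    exact (hK _ _ _).trans (le_abs_self K)
  · rintro h ⟨C, hC, a', ha', T', hgain⟩
    have hex := hdev _ _ C hC a' ha' T'
    set o : Outcome N A := ⟨a', C, splice C T' (G.phasePlan δ V alt tr h).trans⟩ with ho
    have hphase : G.phase δ V (h ++ [o]) = (some hex.choose, 0) := by
      rw [phase, List.foldl_append, ← phase]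
      simp only [List.foldl_cons, List.foldl_nil, nextPhase]
      rw [if_neg hC.ne_empty]
      exact dif_pos hex
    have h1 := hgain _ hex.choose_spec.1
    have h2 := hex.choose_spec.2
    rw [hval, hval, hphase] at h1
    exact absurd h2 (not_le.mpr h1)

end Automaton

end StageGame

end Convention

end

/-! ### Targets, punishments and the choice of constants -/

noncomputable section

namespace Convention.StageGame

open Finset

variable {N A : Type*} [Fintype N] (G : StageGame N A)

/-- The total is linear, so bounds on the generating hyperplanes pass to their convex hull. -/
theorem exists_sum_bounds_of_mem_feasible [Finite A] [Nonempty A] :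
    ∃ a₀ a₁ : A, ∀ u ∈ G.feasible, ∑ i, G.v a₀ i ≤ ∑ i, u i ∧ ∑ i, u i ≤ ∑ i, G.v a₁ i := by
  obtain ⟨a₀, h₀⟩ := Finite.exists_min fun a => ∑ i, G.v a i
  obtain ⟨a₁, h₁⟩ := Finite.exists_max fun a => ∑ i, G.v a i
  refine ⟨a₀, a₁, fun u hu => ?_⟩
  have hlin : IsLinearMap ℝ fun u : N → ℝ => ∑ i, u i :=
    ⟨fun x y => by simp [sum_add_distrib], fun c x => by simp [mul_sum]⟩
  have hsub : (⋃ a, G.payoffsAt a) ⊆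
      (fun u : N → ℝ => ∑ i, u i) ⁻¹' Set.Icc (∑ i, G.v a₀ i) (∑ i, G.v a₁ i) := by
    intro x hx
    obtain ⟨a, ha⟩ := Set.mem_iUnion.mp hx
    have ha' : ∑ i, x i = ∑ i, G.v a i := ha
    exact ⟨(h₀ a).trans ha'.ge, ha'.le.trans (h₁ a)⟩
  exact convexHull_min hsub ((convex_Icc _ _).is_linear_preimage hlin) hu

/-- Sharing the difference between the total payoff and a target total equally. -/
theorem exists_transfers_payoff_eq (w : N → ℝ) (a : A) :
    ∃ T : Matrix N N ℝ≥0, ∀ i,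
      G.payoff a T i = w i + (∑ j, G.v a j - ∑ j, w j) / Fintype.card N := by
  obtain ⟨T, hT⟩ := exists_transfers
    (fun i => w i + (∑ j, G.v a j - ∑ j, w j) / Fintype.card N - G.v a i) (by
      rcases isEmpty_or_nonempty N with hN | hN
      · simp
      · have : (Fintype.card N : ℝ) ≠ 0 := Nat.cast_ne_zero.mpr Fintype.card_ne_zero
        simp only [sum_sub_distrib, sum_add_distrib, sum_const, card_univ, nsmul_eq_mul]
        field_simp
        ring)
  refine ⟨T, fun i => ?_⟩
  have := hT i
  rw [payoff]
  linarith

variable [DecidableEq N]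

variable {G} in
/-- If no member of a blocking coalition is worse off than in the own punishment, and one of them
is better off by more than what the coalition can gain today, then some member does not gain. -/
theorem exists_not_gain {δ μ B : ℝ} (hδ1 : δ < 1) {C : Finset N} {a : A} {T' T : Matrix N N ℝ≥0}
    {p V : N → ℝ} (hB : ∑ i ∈ C, (G.v a i - G.minmax i) + ∑ i ∈ C, ∑ j, (T j i : ℝ) ≤ B)
    (hμ : (1 - δ) * B ≤ μ) (hp : ∀ i, G.minmax i ≤ p i) (hV : ∀ i ∈ C, p i ≤ V i)
    {k : N} (hk : k ∈ C) (hkV : p k + μ ≤ V k) :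
    ∃ i ∈ C, (1 - δ) * G.payoff a (splice C T' T) i + δ * p i ≤ V i := by
  by_contra! hcon
  -- Summing over the coalition removes its internal transfers; the slack `μ` of `k` then exceeds
  -- any joint gain.
  have h1 := sum_lt_sum_of_nonempty ⟨k, hk⟩ hcon
  rw [sum_add_distrib, ← mul_sum, ← mul_sum] at h1
  have h2 : ∑ i ∈ C, p i + μ ≤ ∑ i ∈ C, V i := by
    rw [← add_sum_erase C p hk, ← add_sum_erase C V hk]
    have := sum_le_sum fun i (hi : i ∈ C.erase k) => hV i (mem_of_mem_erase hi)
    linarith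
  have h3 := G.sum_payoff_splice_le C a T' T
  have h4 : ∑ i ∈ C, G.minmax i ≤ ∑ i ∈ C, p i := sum_le_sum fun i _ => hp i
  rw [sum_sub_distrib] at hB
  have h5 : (1 - δ) * (∑ i ∈ C, G.payoff a (splice C T' T) i - ∑ i ∈ C, p i) ≤ (1 - δ) * B :=
    mul_le_mul_of_nonneg_left (by linarith) (by linarith)
  linarith

/-- Stable conventions for a fixed discount factor. The targets `w none` and `w (some i)` are the
payoffs on the path and after the punishment of player `i`. -/
theorem exists_stable_of_targets (b : N → A)
    (hb : ∀ i, ∀ a' ∈ G.E {i} (b i), G.v a' i ≤ G.minmax i) (w : Option N → N → ℝ)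
    {η θ R B Kv δ : ℝ} (hη : 0 < η) (hw : ∀ i, G.minmax i + η ≤ w (some i) i)
    (hle : ∀ g i, w (some i) i ≤ w g i)
    (hgap : ∀ k i, i ≠ k → w (some i) i + η ≤ w (some k) i)
    (a₀ a₁ : A) (h₀ : ∀ g, ∑ i, G.v a₀ i ≤ ∑ i, w g i) (h₁ : ∀ g, ∑ i, w g i ≤ ∑ i, G.v a₁ i)
    (τ : Option N → A → Matrix N N ℝ≥0)
    (hτ : ∀ g a i, G.payoff a (τ g a) i =
      w g i + (∑ j, G.v a j - ∑ j, w g j) / Fintype.card N)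
    (hR : ∀ g i a, |w g i - G.v a i| ≤ R) (hKv : ∀ a i, |G.v a i| ≤ Kv)
    (hB : ∀ g a a' (C : Finset N),
      ∑ i ∈ C, (G.v a' i - G.minmax i) + ∑ i ∈ C, ∑ j, (τ g a j i : ℝ) ≤ B)
    (hθ0 : 0 < θ) (hθ1 : θ < 1) (hθR : 4 * θ * R ≤ η)
    (hδ : 1 / 2 ≤ δ) (hδθ : 1 - θ ≤ δ) (hδ1 : δ < 1)
    (hδS : 4 * (1 - δ) * (∑ i, G.v a₁ i - ∑ i, G.v a₀ i) ≤ θ * η / 2)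
    (hδB : (1 - δ) * B ≤ θ * η / 2) :
    ∃ σ : Plan N A, IsConvention σ ∧ G.BoundedValues δ σ ∧ G.IsStable δ σ ∧
      ∀ i, G.value δ σ [] i = w none i := by
  have hδ0 : 0 ≤ δ := by linarith
  obtain ⟨L, hL1, hL2⟩ := exists_pow_mem_Icc hθ0 hθ1 hδθ hδ1
  choose c W hW0 hW hWb using fun g => exists_two_value_path hδ hδ1 (h₀ g) (h₁ g)
  set S₀ := ∑ i, G.v a₀ i
  set S₁ := ∑ i, G.v a₁ i
  let sel : Option N → ℕ → A := fun g t => if c g t then a₁ else a₀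
  let ℓ : Option N → ℕ := fun g => g.elim 0 fun _ => L
  let pun : Option N → A := fun g => g.elim a₀ b
  let X : Option N → ℕ → N → ℝ := fun g t i => w g i + (W g t - ∑ j, w g j) / Fintype.card N
  -- Truncated subtraction covers both stages: `ℓ g - t` counts the remaining punishment periods and
  -- `t - ℓ g` the periods since they ended.
  let V : Option N → ℕ → N → ℝ := fun g t i =>
    (1 - δ ^ (ℓ g - t)) * G.v (pun g) i + δ ^ (ℓ g - t) * X g (t - ℓ g) i
  let alt : Option N → ℕ → A := fun g t => if t < ℓ g then pun g else sel g (t - ℓ g)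
  let tr : Option N → ℕ → Matrix N N ℝ≥0 := fun g t =>
    if t < ℓ g then 0 else τ g (sel g (t - ℓ g))
  have hcard : ∀ i : N, (1 : ℝ) ≤ Fintype.card N := fun i =>
    Nat.one_le_cast.mpr (Fintype.card_pos_iff.mpr ⟨i⟩)
  have hX0 : ∀ g i, X g 0 i = w g i := fun g i => by simp [X, hW0]
  have hXrec : ∀ g t i, X g t i =
      (1 - δ) * G.payoff (sel g t) (τ g (sel g t)) i + δ * X g (t + 1) i := by
    intro g t i
    have hsel : ∑ j, G.v (sel g t) j = if c g t then S₁ else S₀ := by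
      simp only [sel]; split_ifs <;> rfl
    simp only [X]
    rw [hτ, hsel, hW g t]
    ring
  have hXlow : ∀ g t i, w (some i) i - θ * η / 2 ≤ X g t i := by
    intro g t i
    have h1 := (hWb g t).2.2
    have h2 : -(θ * η / 2) ≤ (W g t - ∑ j, w g j) / Fintype.card N := by
      have := hcard i
      rw [le_div_iff₀ (by linarith)]
      nlinarith [mul_pos hθ0 hη]
    have := hle g i
    simp only [X]
    linarith
  have hXabs : ∀ g t i, |X g t i - w g i| ≤ S₁ - S₀ := by
    intro g t i
    have hn := hcard i
    simp only [X, add_sub_cancel_left]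
    rw [abs_div, abs_of_nonneg (by linarith : (0 : ℝ) ≤ Fintype.card N)]
    refine (div_le_self (abs_nonneg _) hn).trans (abs_le.mpr ?_)
    obtain ⟨h1, h2, -⟩ := hWb g t
    have h3 := h₀ g
    have h4 := h₁ g
    constructor <;> linarith
  have hpow : ∀ k, 0 ≤ δ ^ k ∧ δ ^ k ≤ 1 := fun k =>
    ⟨pow_nonneg hδ0 k, pow_le_one₀ hδ0 hδ1.le⟩
  have hVabs : ∀ g t i, |V g t i| ≤ Kv + ((S₁ - S₀) + R) := by
    intro g t i
    have hV' : V g t i = G.v (pun g) i +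
        δ ^ (ℓ g - t) * ((X g (t - ℓ g) i - w g i) + (w g i - G.v (pun g) i)) := by
      simp only [V]; ring
    rw [hV']
    refine (abs_add_le _ _).trans (add_le_add (hKv _ _) ?_)
    rw [abs_mul, abs_of_nonneg (hpow _).1]
    refine (mul_le_of_le_one_left (abs_nonneg _) (hpow _).2).trans ?_
    exact (abs_add_le _ _).trans (add_le_add (hXabs _ _ _) (hR _ _ _))
  have hVrec : ∀ g t i,
      V g t i = (1 - δ) * G.payoff (alt g t) (tr g t) i + δ * V g (t + 1) i := by
    intro g t i
    by_cases ht : t < ℓ g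
    · obtain ⟨m, hm⟩ : ∃ m, ℓ g = t + 1 + m := ⟨ℓ g - (t + 1), by omega⟩
      simp only [V, alt, tr, if_pos ht]
      rw [show ℓ g - t = m + 1 by omega, show ℓ g - (t + 1) = m by omega,
        show t - ℓ g = 0 by omega, show t + 1 - ℓ g = 0 by omega]
      simp only [payoff, Matrix.zero_apply, NNReal.coe_zero, sum_const_zero]
      ring
    · simp only [V, alt, tr, if_neg ht]
      rw [show ℓ g - t = 0 by omega, show ℓ g - (t + 1) = 0 by omega,
        show t + 1 - ℓ g = t - ℓ g + 1 by omega]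
      simp only [pow_zero, sub_self, zero_mul, one_mul, zero_add]
      exact hXrec g (t - ℓ g) i
  have hvb : ∀ i, G.v (b i) i ≤ G.minmax i := fun i =>
    hb i (b i) (G.refl _ (singleton_nonempty i) _)
  have hVpun : ∀ k t i, t < L → V (some k) t i =
      w (some k) i - (1 - δ ^ (L - t)) * (w (some k) i - G.v (b k) i) := by
    intro k t i ht
    simp only [V, ℓ, pun, Option.elim_some]
    rw [show t - L = 0 by omega, hX0]
    ring
  have hLpos : 0 < L := by
    rcases Nat.eq_zero_or_pos L with h | h
    · rw [h, pow_zero] at hL2; linarith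
    · exact h
  have hp : ∀ i, V (some i) 0 i = w (some i) i - (1 - δ ^ L) * (w (some i) i - G.v (b i) i) :=
    fun i => hVpun i 0 i hLpos
  have hpow_le : ∀ t, δ ^ L ≤ δ ^ (L - t) := fun t =>
    pow_le_pow_of_le_one hδ0 hδ1.le (Nat.sub_le L t)
  -- Punishment has weight at most `2 * θ`, so it costs anyone at most `2 * θ * R ≤ η / 2`.
  have hVpun_low : ∀ k t i, t < L → w (some k) i - η / 2 ≤ V (some k) t i := by
    intro k t i ht
    rw [hVpun k t i ht]
    have h1 := (abs_le.mp (hR (some k) i (b k))).2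
    have h2 := hpow_le t
    have h3 := (hpow (L - t)).2
    have h4 : (1 - δ ^ (L - t)) * (w (some k) i - G.v (b k) i) ≤ 2 * θ * R := by
      have hR0 : 0 ≤ R := (abs_nonneg _).trans (hR (some k) i (b k))
      calc _ ≤ (1 - δ ^ (L - t)) * R := mul_le_mul_of_nonneg_left h1 (by linarith)
        _ ≤ 2 * θ * R := mul_le_mul_of_nonneg_right (by linarith) hR0
    linarith
  have hp_up : ∀ i, V (some i) 0 i ≤ w (some i) i - θ * η := by
    intro i
    rw [hp]
    have h1 : η ≤ w (some i) i - G.v (b i) i := by linarith [hw i, hvb i]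
    have := mul_le_mul (by linarith : θ ≤ 1 - δ ^ L) h1 hη.le (by linarith)
    linarith
  have hp_low : ∀ i, G.minmax i ≤ V (some i) 0 i := by
    intro i
    linarith [hVpun_low i 0 i hLpos, hw i]
  have hθη : θ * η ≤ η := mul_le_of_le_one_left hη.le hθ1.le
  have hθη0 : 0 < θ * η := mul_pos hθ0 hη
  -- The punished player's value rises as fewer minmax periods remain.
  have hVown : ∀ k t, t < L → V (some k) 0 k ≤ V (some k) t k := by
    intro k t ht
    rw [hp, hVpun k t k ht]
    have := hpow_le t
    have := mul_le_mul_of_nonneg_right (by linarith : 1 - δ ^ (L - t) ≤ 1 - δ ^ L)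
      (by linarith [hw k, hvb k] : 0 ≤ w (some k) k - G.v (b k) k)
    linarith
  have hVother : ∀ k t i, t < L → i ≠ k → V (some i) 0 i + θ * η / 2 ≤ V (some k) t i := by
    intro k t i ht hik
    linarith [hVpun_low k t i ht, hgap k i hik, hp_up i]
  have hdev : ∀ g t (C : Finset N), C.Nonempty → ∀ a' ∈ G.E C (alt g t),
      ∀ T' : Matrix N N ℝ≥0, ∃ i ∈ C,
        (1 - δ) * G.payoff a' (splice C T' (tr g t)) i + δ * V (some i) 0 i ≤ V g t i := by
    intro g t C hC a' ha' T'
    by_cases ht : t < ℓ g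
    · obtain _ | k := g
      · exact absurd ht (Nat.not_lt_zero t)
      have htL : t < L := ht
      have htr : tr (some k) t = 0 := if_pos ht
      have halt : alt (some k) t = b k := if_pos ht
      rw [htr]
      by_cases hj : ∃ j ∈ C, j ≠ k
      · obtain ⟨j, hjC, hjk⟩ := hj
        refine exists_not_gain (p := fun i => V (some i) 0 i) hδ1 ?_ hδB hp_low
          (fun i _ => ?_) hjC (hVother k t j htL hjk)
        -- No transfers are prescribed here, so any instance of the bound serves: its receipts are
        -- nonnegative.
        · refine le_trans ?_ (hB none a₀ a' C)
          gcongr with i _ j _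
          simp
        · by_cases hik : i = k
          · exact hik ▸ hVown k t htL
          · linarith [hVother k t i htL hik]
      · push Not at hj
        obtain rfl : C = {k} := eq_singleton_iff_nonempty_unique_mem.mpr ⟨hC, hj⟩
        refine ⟨k, mem_singleton_self k, ?_⟩
        have h1 := G.sum_payoff_splice_le {k} a' T' 0
        simp only [sum_singleton, Matrix.zero_apply, NNReal.coe_zero, sum_const_zero,
          add_zero] at h1
        have h2 := hb k a' (halt ▸ ha')
        have h3 := hp_low k
        have h4 := hVown k t htL
        have h5 := mul_le_mul_of_nonneg_left ((h1.trans h2).trans h3) (by linarith : 0 ≤ 1 - δ)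
        linarith
    · have htr : tr g t = τ g (sel g (t - ℓ g)) := if_neg ht
      have hVX : V g t = X g (t - ℓ g) := by
        funext i
        simp only [V]
        rw [show ℓ g - t = 0 by omega]
        ring
      have hm : ∀ i, V (some i) 0 i + θ * η / 2 ≤ V g t i := fun i => by
        rw [hVX]
        linarith [hXlow g (t - ℓ g) i, hp_up i]
      obtain ⟨j, hj⟩ := hC
      rw [htr]
      exact exists_not_gain (p := fun i => V (some i) 0 i) hδ1 (hB _ _ _ _) hδB hp_low
        (fun i _ => by linarith [hm i]) hj (hm j)
  obtain ⟨σ, h1, h2, h3, h4⟩ :=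
    G.exists_stable_of_phases hδ0 hδ1 alt tr V _ hVabs hVrec hdev
  refine ⟨σ, h1, h2, h3, fun i => ?_⟩
  rw [h4]
  simp [V, ℓ, hX0]

/-- Every feasible and strictly individually rational payoff profile is supported by a stable
convention when players are patient. -/
theorem exists_stable_of_mem_feasibleIR [Finite A] {u : N → ℝ} (hu : u ∈ G.feasibleIR) :
    ∃ δ₀ : ℝ, 0 ≤ δ₀ ∧ δ₀ < 1 ∧ ∀ δ : ℝ, δ₀ < δ → δ < 1 →
      ∃ σ : Plan N A, IsConvention σ ∧ G.BoundedValues δ σ ∧ G.IsStable δ σ ∧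
        ∀ i, G.value δ σ [] i = u i := by
  obtain ⟨huf, huIR⟩ := hu
  have hA : Nonempty A := by
    obtain ⟨x, hx⟩ := convexHull_nonempty_iff.mp ⟨u, huf⟩
    exact (Set.mem_iUnion.mp hx).nonempty
  obtain ⟨a₀, a₁, hS⟩ := G.exists_sum_bounds_of_mem_feasible
  choose b hb using G.exists_forall_le_minmax
  set n : ℝ := (Fintype.card N : ℝ) with hn
  have hn0 : 0 ≤ n := Nat.cast_nonneg _
  obtain ⟨η, hη, hηu⟩ : ∃ η : ℝ, 0 < η ∧ ∀ i, G.minmax i + n * η ≤ u i := by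
    rcases isEmpty_or_nonempty N with hN | hN
    · exact ⟨1, one_pos, fun i => hN.elim i⟩
    · obtain ⟨k, hk⟩ := Finite.exists_min fun i => u i - G.minmax i
      refine ⟨(u k - G.minmax k) / (n + 1), div_pos (sub_pos.mpr (huIR k)) (by linarith),
        fun i => ?_⟩
      have h1 : n * ((u k - G.minmax k) / (n + 1)) ≤ u k - G.minmax k := by
        rw [mul_div_assoc', div_le_iff₀ (by linarith)]
        nlinarith [huIR k]
      linarith [hk i]
  -- Player `k` gives up `n * η`, which is shared equally among all, so the total is unchanged.
  let w : Option N → N → ℝ := fun g i => g.elim (u i) fun k => u i + η - if i = k then n * η else 0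
  have hcard : ∀ i : N, (1 : ℝ) ≤ n := fun i =>
    Nat.one_le_cast.mpr (Fintype.card_pos_iff.mpr ⟨i⟩)
  have hwsum : ∀ g, ∑ i, w g i = ∑ i, u i := by
    rintro (_ | k)
    · rfl
    · simp [w, sum_add_distrib, sum_sub_distrib, hn]
  have hw_own : ∀ i, w (some i) i = u i + η - n * η := fun i => by simp [w]
  have hw_other : ∀ k i, i ≠ k → w (some k) i = u i + η := fun k i h => by simp [w, h]
  have hηn : ∀ i : N, η ≤ n * η := fun i => le_mul_of_one_le_left hη.le (hcard i)
  have hw : ∀ i, G.minmax i + η ≤ w (some i) i := fun i => by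
    rw [hw_own]; linarith [hηu i]
  have hgap : ∀ k i, i ≠ k → w (some i) i + η ≤ w (some k) i := fun k i h => by
    rw [hw_own, hw_other k i h]; linarith [hηn i]
  have hle : ∀ g i, w (some i) i ≤ w g i := by
    rintro (_ | k) i
    · rw [hw_own]
      change _ ≤ u i
      linarith [hηn i]
    · by_cases h : i = k
      · rw [h]
      · linarith [hgap k i h]
  choose τ hτ using fun g => G.exists_transfers_payoff_eq (w g)
  obtain ⟨R, hR⟩ := (Set.finite_range
    fun x : Option N × N × A => |w x.1 x.2.1 - G.v x.2.2 x.2.1|).bddAbove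
  obtain ⟨Kv, hKv⟩ := (Set.finite_range fun x : A × N => |G.v x.1 x.2|).bddAbove
  obtain ⟨B, hB⟩ := (Set.finite_range fun x : Option N × A × A × Finset N =>
    ∑ i ∈ x.2.2.2, (G.v x.2.2.1 i - G.minmax i) +
      ∑ i ∈ x.2.2.2, ∑ j, (τ x.1 x.2.1 j i : ℝ)).bddAbove
  set D := ∑ i, G.v a₁ i - ∑ i, G.v a₀ i
  have hD : 0 ≤ D := by have := hS u huf; simp only [D]; linarith
  obtain ⟨θ, hθ0, hθ1, hθR⟩ : ∃ θ : ℝ, 0 < θ ∧ θ < 1 ∧ 4 * θ * R ≤ η := by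
    have hden : 0 < 4 * |R| + η + 1 := by positivity
    refine ⟨η / (4 * |R| + η + 1), by positivity, ?_, ?_⟩
    · rw [div_lt_one hden]; linarith [abs_nonneg R]
    · rw [show 4 * (η / (4 * |R| + η + 1)) * R = 4 * η * R / (4 * |R| + η + 1) by ring,
        div_le_iff₀ hden]
      nlinarith [le_abs_self R, mul_le_mul_of_nonneg_left (le_abs_self R) hη.le]
  -- The own punishment costs `θ * η`: half absorbs the fluctuation of the path, half deters the
  -- joint gain.
  have hμ : 0 < θ * η / 2 := by positivity
  obtain ⟨ε, hε0, hε2, hεθ, hεD⟩ : ∃ ε : ℝ, 0 < ε ∧ ε ≤ 1 / 2 ∧ ε ≤ θ ∧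
      ε * (4 * D + |B|) ≤ θ * η / 2 := by
    have hden : 0 < 4 * D + |B| + 1 := by positivity
    refine ⟨min (1 / 2) (min θ (θ * η / 2 / (4 * D + |B| + 1))), by positivity,
      min_le_left _ _, (min_le_right _ _).trans (min_le_left _ _), ?_⟩
    have h1 : min (1 / 2) (min θ (θ * η / 2 / (4 * D + |B| + 1))) ≤
      θ * η / 2 / (4 * D + |B| + 1) := (min_le_right _ _).trans (min_le_right _ _)
    refine (mul_le_mul_of_nonneg_right h1 (by positivity)).trans ?_
    rw [div_mul_eq_mul_div, div_le_iff₀ hden]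
    nlinarith
  refine ⟨1 - ε, by linarith, by linarith, fun δ hδ hδ1 => ?_⟩
  have hlt : (1 - δ) * (4 * D + |B|) ≤ θ * η / 2 :=
    (mul_le_mul_of_nonneg_right (by linarith) (by positivity)).trans hεD
  have he : 0 ≤ 1 - δ := by linarith
  refine G.exists_stable_of_targets b hb w (Kv := Kv) hη hw hle hgap a₀ a₁
    (fun g => hwsum g ▸ (hS u huf).1) (fun g => hwsum g ▸ (hS u huf).2) τ hτ
    (fun g i a => hR ⟨(g, i, a), rfl⟩) (fun a i => hKv ⟨(a, i), rfl⟩)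
    (fun g a a' C => hB ⟨(g, a, a', C), rfl⟩) hθ0 hθ1 hθR (by linarith) (by linarith) hδ1 ?_ ?_
  · have := mul_nonneg he (abs_nonneg B)
    linarith
  · have h1 := mul_nonneg he hD
    have h2 := mul_le_mul_of_nonneg_left (le_abs_self B) he
    linarith

end Convention.StageGame

end

theorem theorem2 {N A : Type*} [Fintype N] [DecidableEq N] [Finite A]
    (G : Convention.StageGame N A) :
    (∀ δ : ℝ, 0 ≤ δ → δ < 1 → ∀ σ : Convention.Plan N A,
      Convention.IsConvention σ → G.BoundedValues δ σ → G.IsStable δ σ →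
        ∀ i, G.minmax i ≤ G.value δ σ [] i) ∧
    (∀ u ∈ G.feasibleIR, ∃ δ₀ : ℝ, 0 ≤ δ₀ ∧ δ₀ < 1 ∧ ∀ δ : ℝ, δ₀ < δ → δ < 1 →
      ∃ σ : Convention.Plan N A,
        Convention.IsConvention σ ∧ G.BoundedValues δ σ ∧ G.IsStable δ σ ∧
          ∀ i, G.value δ σ [] i = u i) := by
  exact ⟨fun δ hδ0 hδ1 σ _ hb hs i => G.minmax_le_value hδ0 hδ1 hb hs [] i,
    fun u hu => G.exists_stable_of_mem_feasibleIR hu⟩
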